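/- Let $(M,g)$ be a compact connected smooth Riemannian manifold (without boundary), and let $\mathcal E\to M$ be a smooth oriented real vector bundle of finite rank with a smooth fibre metric $\langle\cdot,\cdot\rangle$ and a smooth connection $\nabla$ compatible with it. For $p,q\in\mathbb R$ and a smooth section $\sigma$ of $\mathcal E$, the vertical $(p,q)$-energy of $\sigma$ is $$E^v_{p,q}(\sigma)=\frac12\int_M\frac{1}{(1+|\sigma|^2)^{p}}\sum_i\Bigl(|\nabla_{E_i}\sigma|^2+q\,\langle\nabla_{E_i}\sigma,\sigma\rangle^2\Bigr)\,\mathrm{vol}(g),$$ where $(E_i)$ is an orthonormal basis of the tangent space. This is $\frac12\int_M|d^v\sigma|^2\,\mathrm{vol}(g)$, where $d^v\sigma=\nabla\sigma$ is the vertical part of $d\sigma$ and its norm is taken in the (possibly indefinite) metric $h_{p,q}$ on the total space of $\mathcal E$, given on vertical vectors $a,b$ at $e\in\mathcal E$ by $(1+|e|^2)^{-p}(\langle a,b\rangle+q\langle a,e\rangle\langle b,e\rangle)$. The section $\sigma$ is called $(p,q)$-harmonic if $\frac{d}{dt}\big|_{t=0}E^v_{p,q}(\sigma_t)=0$ for every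 smooth variation $(\sigma_t)_{t\in\mathbb R}$ of $\sigma=\sigma_0$ through sections of $\mathcal E$. **Theorem B.** Suppose that the Euler class $\chi(\mathcal E)\in H^{\operatorname{rank}\mathcal E}(M;\mathbb Z)$ is non-zero, and let $\sigma$ be a smooth section of $\mathcal E$ that is not identically zero. Write $\|\sigma\|_\infty=\sup_{x\in M}|\sigma(x)|$. Then for each $p\in\mathbb R$ there is at most one $q\in\mathbb R$ such that $\sigma$ is $(p,q)$-harmonic. Moreover, if $\sigma$ is $(p,q)$-harmonic, then: - (a) if $-4\le p\le-1$, then $q<-1-p$; - (b) if $-1\le p\le1$, then $q<0$; - (c) if $1<p\le2$ and $\|\sigma\|_\infty\le1/\sqrt{p-1}$, then $q<0$; - (d) if $p\ge2$ and $\|\sigma\|_\infty\le1/\sqrt{p-1}$, then $q<1-p/2$. -/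

import Mathlib

open Bundle Manifold MeasureTheory Topology
open scoped ContDiff

/-! ### Singular cohomology of pairs with integer coefficients -/

namespace SingularCoh

/-- A singular `k`-simplex in `X`. -/
abbrev Simplex (X : Type*) [TopologicalSpace X] (k : ℕ) : Type _ :=
  C(stdSimplex ℝ (Fin (k + 1)), X)

/-- The `i`-th face of a singular simplex: the face opposite to the `i`-th vertex. -/
noncomputable def face {X : Type*} [TopologicalSpace X] {k : ℕ} (s : Simplex X (k + 1))
    (i : Fin (k + 2)) : Simplex X k :=
  s.comp ⟨stdSimplex.map i.succAbove, stdSimplex.continuous_map _⟩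

/-- The singular coboundary `(δ c)(s) = ∑ i, (-1) ^ i c(∂_i s)`. -/
noncomputable def coboundary (X : Type*) [TopologicalSpace X] (k : ℕ) :
    (Simplex X k → ℤ) →+ (Simplex X (k + 1) → ℤ) where
  toFun c s := ∑ i : Fin (k + 2), (-1) ^ (i : ℕ) * c (face s i)
  map_zero' := by ext; simp
  map_add' c d := by ext; simp [mul_add, Finset.sum_add_distrib]

/-- The cochains of the pair `(X, A)`: those that vanish on all simplices lying in `A`. -/
def cochains {X : Type*} [TopologicalSpace X] (A : Set X) (k : ℕ) :
    AddSubgroup (Simplex X k → ℤ) where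
  carrier := {c | ∀ s : Simplex X k, Set.range s ⊆ A → c s = 0}
  zero_mem' := by intro s _; rfl
  add_mem' := by intro c d hc hd s hs; simp [hc s hs, hd s hs]
  neg_mem' := by intro c hc s hs; simp [hc s hs]

/-- The cocycles of the pair `(X, A)`. -/
noncomputable def cocycles {X : Type*} [TopologicalSpace X] (A : Set X) (k : ℕ) :
    AddSubgroup (Simplex X k → ℤ) :=
  cochains A k ⊓ (coboundary X k).ker

/-- The coboundaries of the pair `(X, A)`. -/
noncomputable def coboundaries {X : Type*} [TopologicalSpace X] (A : Set X) :
    (k : ℕ) → AddSubgroup (Simplex X k → ℤ)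
  | 0 => ⊥
  | k + 1 => (cochains A k).map (coboundary X k)

/-- The singular cohomology group `H^k(X, A; ℤ)`.  Taking `A = ∅` gives `H^k(X; ℤ)`. -/
abbrev Cohomology {X : Type*} [TopologicalSpace X] (A : Set X) (k : ℕ) : Type _ :=
  cocycles A k ⧸ (coboundaries A k).addSubgroupOf (cocycles A k)

/-- The pullback of cochains along a continuous map. -/
def pullbackCochain {X Y : Type*} [TopologicalSpace X] [TopologicalSpace Y] (f : C(X, Y))
    (k : ℕ) : (Simplex Y k → ℤ) →+ (Simplex X k → ℤ) where
  toFun c s := c (f.comp s)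
  map_zero' := rfl
  map_add' _ _ := rfl

theorem coboundary_pullbackCochain {X Y : Type*} [TopologicalSpace X] [TopologicalSpace Y]
    (f : C(X, Y)) (k : ℕ) (c : Simplex Y k → ℤ) :
    coboundary X k (pullbackCochain f k c) = pullbackCochain f (k + 1) (coboundary Y k c) :=
  rfl

theorem pullbackCochain_mem_cochains {X Y : Type*} [TopologicalSpace X] [TopologicalSpace Y]
    (f : C(X, Y)) {A : Set X} {B : Set Y} (hf : Set.MapsTo f A B) {k : ℕ}
    {c : Simplex Y k → ℤ} (hc : c ∈ cochains B k) : pullbackCochain f k c ∈ cochains A k := by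
  intro s hs
  refine hc (f.comp s) ?_
  rintro _ ⟨t, rfl⟩
  exact hf (hs ⟨t, rfl⟩)

theorem pullbackCochain_mem_cocycles {X Y : Type*} [TopologicalSpace X] [TopologicalSpace Y]
    (f : C(X, Y)) {A : Set X} {B : Set Y} (hf : Set.MapsTo f A B) {k : ℕ}
    {c : Simplex Y k → ℤ} (hc : c ∈ cocycles B k) : pullbackCochain f k c ∈ cocycles A k := by
  refine ⟨pullbackCochain_mem_cochains f hf hc.1, ?_⟩
  have h : coboundary Y k c = 0 := hc.2
  change coboundary X k (pullbackCochain f k c) = 0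
  rw [coboundary_pullbackCochain, h, map_zero]

theorem pullbackCochain_mem_coboundaries {X Y : Type*} [TopologicalSpace X]
    [TopologicalSpace Y] (f : C(X, Y)) {A : Set X} {B : Set Y} (hf : Set.MapsTo f A B) :
    ∀ {k : ℕ} {c : Simplex Y k → ℤ}, c ∈ coboundaries B k →
      pullbackCochain f k c ∈ coboundaries A k
  | 0, c, hc => by
    have h : c = 0 := hc
    rw [h, map_zero]
    exact zero_mem _
  | k + 1, _, ⟨d, hd, rfl⟩ =>
    ⟨pullbackCochain f k d, pullbackCochain_mem_cochains f hf hd,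
      coboundary_pullbackCochain f k d⟩

/-- The homomorphism `f^* : H^k(Y, B; ℤ) → H^k(X, A; ℤ)` induced by a map of pairs
`f : (X, A) → (Y, B)`. -/
noncomputable def pullback {X Y : Type*} [TopologicalSpace X] [TopologicalSpace Y] (f : C(X, Y))
    {A : Set X} {B : Set Y} (hf : Set.MapsTo f A B) (k : ℕ) :
    Cohomology B k →+ Cohomology A k :=
  QuotientAddGroup.map _ _
    (((pullbackCochain f k).comp (cocycles B k).subtype).codRestrict (cocycles A k)
      fun c => pullbackCochain_mem_cocycles f hf c.2)
    fun _ hc => pullbackCochain_mem_coboundaries f hf hc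

end SingularCoh

/-! ### Oriented vector bundles and the Euler class -/

namespace EulerClass

open SingularCoh

variable {M : Type*} [TopologicalSpace M]
  (F : Type*) [NormedAddCommGroup F] [NormedSpace ℝ F]
  (V : M → Type*) [TopologicalSpace (TotalSpace F V)]
  [∀ x, NormedAddCommGroup (V x)] [∀ x, NormedSpace ℝ (V x)]
  [FiberBundle F V] [VectorBundle ℝ F V]

/-- An orientation of a real vector bundle: an orientation of each fibre which is locally
constant in the local trivializations. -/
structure BundleOrientation where
  /-- the orientation of the fibre over `x` -/
  fibre : ∀ x : M, Orientation ℝ (V x) (Fin (Module.finrank ℝ F))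
  locallyConstant : ∀ x₀ : M, ∃ oF : Orientation ℝ F (Fin (Module.finrank ℝ F)),
    ∀ᶠ x in 𝓝 x₀, ∀ hx : x ∈ (trivializationAt F V x₀).baseSet,
      Orientation.map (Fin (Module.finrank ℝ F))
        ((trivializationAt F V x₀).linearEquivAt ℝ x hx) (fibre x) = oF

/-- The complement of the zero section in the total space. -/
def nonzeroVectors : Set (TotalSpace F V) := {z | z.2 ≠ 0}

/-- The bundle projection as a continuous map. -/
def projection : C(TotalSpace F V, M) := ⟨TotalSpace.proj, FiberBundle.continuous_proj F V⟩

variable {F V}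

/-- The affine singular `r`-simplex in the fibre `V x` (where `r` is the rank) with
barycentre `0` and with edge vectors `v₁ - v₀, …, v_r - v₀` equal to the given basis `b`. Its
boundary lies in the nonzero vectors. -/
noncomputable def fibreSimplex (x : M) (b : Module.Basis (Fin (Module.finrank ℝ F)) ℝ (V x)) :
    Simplex (TotalSpace F V) (Module.finrank ℝ F) where
  toFun t := ⟨x, ∑ j, (t j.succ - 1 / ((Module.finrank ℝ F : ℝ) + 1)) • b j⟩
  continuous_toFun := by
    refine (FiberBundle.continuous_totalSpaceMk F V x).comp ?_
    refine continuous_finsetSum _ fun j _ => Continuous.smul ?_ continuous_const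
    exact ((continuous_apply j.succ).comp continuous_subtype_val).sub continuous_const

open Classical in
/-- `u ∈ H^r(E, E \ 0; ℤ)` is the Thom class of the oriented bundle: its restriction to each
`(E_x, E_x \ 0)` is the preferred generator, i.e. takes the value `1` on the relative cycle given
by a positively oriented affine simplex around the origin (and `-1` on a negatively oriented
one).  These values do not depend on the representing cocycle `c`, because the boundary of
`fibreSimplex x b` lies in `E \ 0`. -/
def IsThomClass (o : BundleOrientation F V)
    (u : Cohomology (nonzeroVectors F V) (Module.finrank ℝ F)) : Prop :=
  ∃ c : cocycles (nonzeroVectors F V) (Module.finrank ℝ F), QuotientAddGroup.mk c = u ∧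
    ∀ (x : M) (b : Module.Basis (Fin (Module.finrank ℝ F)) ℝ (V x)),
      c.1 (fibreSimplex x b) = if b.orientation = o.fibre x then 1 else -1

/-- `e ∈ H^r(M; ℤ)` is the Euler class: it corresponds under the isomorphism
`π^* : H^r(M; ℤ) → H^r(E; ℤ)` to the image of the Thom class under
`H^r(E, E \ 0; ℤ) → H^r(E; ℤ)`. -/
def IsEulerClass (o : BundleOrientation F V)
    (e : Cohomology (∅ : Set M) (Module.finrank ℝ F)) : Prop :=
  ∃ u : Cohomology (nonzeroVectors F V) (Module.finrank ℝ F), IsThomClass o u ∧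
    pullback (projection F V) (Set.mapsTo_empty _ _) (Module.finrank ℝ F) e =
      pullback (ContinuousMap.id (TotalSpace F V))
        (Set.mapsTo_empty _ (nonzeroVectors F V)) (Module.finrank ℝ F) u

open Classical in
/-- The Euler class `χ(E) ∈ H^r(M; ℤ)` of an oriented real vector bundle of rank `r`. (It exists
and is unique, by the Thom isomorphism theorem; the default value is never used.) -/
noncomputable def eulerClass (o : BundleOrientation F V) :
    Cohomology (∅ : Set M) (Module.finrank ℝ F) :=
  if h : ∃ e, IsEulerClass o e then h.choose else 0

end EulerClass

/-! ### The Riemannian volume measure -/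

namespace RiemannianVolume

variable {n : ℕ} {M : Type*} [TopologicalSpace M] [ChartedSpace (EuclideanSpace ℝ (Fin n)) M]
  [RiemannianBundle (fun x : M => TangentSpace (𝓡 n) x)]

/-- The density `√(det (g_ij))` of the Riemannian volume in the preferred chart `φ` at `x₀`, at the
point `y` of the target of `φ`; here `g_ij = g(∂_i, ∂_j)` at the point `φ⁻¹ y`, with
`∂_i = d(φ⁻¹)(e_i)`. -/
noncomputable def chartDensity (x₀ : M) (y : EuclideanSpace ℝ (Fin n)) : ℝ :=
  Real.sqrt (Matrix.det (Matrix.of fun i j : Fin n =>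
    inner ℝ
      (mfderiv 𝓘(ℝ, EuclideanSpace ℝ (Fin n)) (𝓡 n) (extChartAt (𝓡 n) x₀).symm y
        (EuclideanSpace.single i (1 : ℝ)))
      (mfderiv 𝓘(ℝ, EuclideanSpace ℝ (Fin n)) (𝓡 n) (extChartAt (𝓡 n) x₀).symm y
        (EuclideanSpace.single j (1 : ℝ)))))

variable (n M)
variable [IsManifold (𝓡 n) ∞ M] [T2Space M] [SigmaCompactSpace M] [MeasurableSpace M]

/-- A smooth partition of unity subordinate to the preferred charts. -/
noncomputable def chartPartition : SmoothPartitionOfUnity M (𝓡 n) M Set.univ :=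
  (SmoothPartitionOfUnity.exists_isSubordinate_chartAt_source (𝓡 n) M).choose

/-- The Riemannian volume measure `vol(g)` (for the Borel σ-algebra of `M`): in local
coordinates it is `√(det (g_ij)) dx`, and the local expressions are glued by a smooth
partition of unity (the result does not depend on the partition). -/
noncomputable def riemannianVolume : Measure M :=
  Measure.sum fun x₀ : M =>
    ((volume.restrict (extChartAt (𝓡 n) x₀).target).withDensity fun y =>
      ENNReal.ofReal (chartPartition n M x₀ ((extChartAt (𝓡 n) x₀).symm y) *
        chartDensity x₀ y)).map (extChartAt (𝓡 n) x₀).symm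

end RiemannianVolume

/-! ### `(p, q)`-harmonic sections -/

namespace PQHarmonic

/-- The restriction of `h_{p,q}` to vertical vectors at the point `e` of a bundle, which are
identified with vectors `a, b` of the fibre through `e`:
`(1 + |e|²)^(-p) (⟨a, b⟩ + q ⟨a, e⟩ ⟨b, e⟩)`. -/
noncomputable def verticalMetric (p q : ℝ) {W : Type*} [NormedAddCommGroup W]
    [InnerProductSpace ℝ W] (e a b : W) : ℝ :=
  (1 / (1 + ‖e‖ ^ 2)) ^ p * (inner ℝ a b + q * inner ℝ a e * inner ℝ b e)

variable {n : ℕ} {M : Type*} [TopologicalSpace M] [ChartedSpace (EuclideanSpace ℝ (Fin n)) M]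
  [IsManifold (𝓡 n) ∞ M] [T2Space M] [SigmaCompactSpace M] [MeasurableSpace M]
  [RiemannianBundle (fun x : M => TangentSpace (𝓡 n) x)]
  {F : Type*} [NormedAddCommGroup F] [NormedSpace ℝ F]
  {V : M → Type*} [TopologicalSpace (TotalSpace F V)]
  [∀ x, NormedAddCommGroup (V x)] [∀ x, InnerProductSpace ℝ (V x)]
  [FiberBundle F V]

/-- `|d^v σ|²` at `x`, with respect to `h_{p,q}`: the sum of `h_{p,q}(∇_{E_i} σ, ∇_{E_i} σ)` over an
orthonormal basis `(E_i)` of `T_x M`, the vertical component of `dσ(X)` being `∇_X σ`. -/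
noncomputable def verticalEnergyDensity (cov : CovariantDerivative (𝓡 n) F V) (p q : ℝ)
    (σ : Π x : M, V x) (x : M) : ℝ :=
  haveI : FiniteDimensional ℝ (TangentSpace (𝓡 n) x) :=
    inferInstanceAs (FiniteDimensional ℝ (EuclideanSpace ℝ (Fin n)))
  ∑ i, verticalMetric p q (σ x)
    (cov σ x (stdOrthonormalBasis ℝ (TangentSpace (𝓡 n) x) i))
    (cov σ x (stdOrthonormalBasis ℝ (TangentSpace (𝓡 n) x) i))

/-- The vertical `(p, q)`-energy `E^v_{p,q}(σ) = ½ ∫_M |d^v σ|² vol(g)`. -/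
noncomputable def verticalEnergy (cov : CovariantDerivative (𝓡 n) F V) (p q : ℝ)
    (σ : Π x : M, V x) : ℝ :=
  (1 / 2) * ∫ x, verticalEnergyDensity cov p q σ x ∂(RiemannianVolume.riemannianVolume n M)

/-- `σ` is a `(p, q)`-harmonic section (of a bundle over a compact manifold): the vertical
`(p, q)`-energy is stationary at `σ` for all smooth variations through sections. -/
def IsPQHarmonic (cov : CovariantDerivative (𝓡 n) F V) (p q : ℝ) (σ : Π x : M, V x) : Prop :=
  ∀ S : ℝ → Π x : M, V x,
    ContMDiff ((𝓡 n).prod 𝓘(ℝ, ℝ)) ((𝓡 n).prod 𝓘(ℝ, F)) ∞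
      (fun z : M × ℝ => TotalSpace.mk' F z.1 (S z.2 z.1)) →
    S 0 = σ →
    HasDerivAt (fun t : ℝ => verticalEnergy cov p q (S t)) 0 0

end PQHarmonic

/-! It suffices to rescale σ along itself. Write u = |σ|², A = |∇σ|², B = |⟨∇σ, σ⟩|². The first
variation of the energy in the direction (1 + u)^a σ is the integral of (1 + u)^(a-p-1) ((1 +
(1-p)u) A + (2a + 2q + q(2a + 2 - p)u) B), so for a (p, q)-harmonic section this integral is zero
for every real a (`IsPQHarmonic.integral_variationDensity_eq_zero`). The exponent a is free and is
chosen case by case.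

Suppose that 1 + (1-p)u ≥ 0 everywhere, which is automatic for p ≤ 1 and is what the bound on the
sup norm provides for p > 1, and that the coefficient of B is non-negative. Then the integrand is
continuous and non-negative, hence identically zero. So (1 + (1-p)u) A = 0, and B ≤ uA gives (1 +
(1-p)u) B = 0, which makes u + (1-p)u²/2 constant. A non-zero Euler class forces σ to vanish
somewhere (`exists_eq_zero_of_eulerClass_ne_zero`), so this constant is 0 and σ = 0
(`eq_zero_of_mul_radialGradSq_eq_zero`), a contradiction.

The choice a = 0 excludes q ≥ 0 whenever p ≤ 2, which covers (a), (b) and (c). The choice a = p/2 -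
1 removes the term in qu and excludes q ≥ 1 - p/2, which is (d). With this same exponent, the first
variations for q and q' differ by 2(q - q') times the integral of B against a positive weight.
Harmonicity for both therefore gives B = 0, so |σ| is constant, again impossible. -/

/-! ### Zeros of sections and the Euler class -/

namespace SingularCoh

/-- A continuous section of the projection annihilates the restriction of relative classes as soon
as its image lies in the subspace. -/
theorem eq_zero_of_pullback_eq_of_mapsTo {X Y : Type*} [TopologicalSpace X] [TopologicalSpace Y]
    (pr : C(Y, X)) (s : C(X, Y)) (hs : ∀ x, pr (s x) = x) {B : Set Y} (hB : ∀ x, s x ∈ B) {k : ℕ}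
    (e : Cohomology (∅ : Set X) k) (u : Cohomology B k)
    (h : pullback pr (Set.mapsTo_empty _ _) k e =
      pullback (ContinuousMap.id Y) (Set.mapsTo_empty _ B) k u) : e = 0 := by
  obtain ⟨e, rfl⟩ := QuotientAddGroup.mk_surjective e
  obtain ⟨u, rfl⟩ := QuotientAddGroup.mk_surjective u
  have h' := QuotientAddGroup.eq.1 h
  rw [QuotientAddGroup.eq_zero_iff]
  have hpr : pr.comp s = ContinuousMap.id X := by ext x; exact hs x
  have h2 := pullbackCochain_mem_coboundaries s (A := (∅ : Set X)) (Set.mapsTo_empty _ _)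
    (AddSubgroup.mem_addSubgroupOf.1 h')
  -- The hypothesis says that -pr^*e + u is a coboundary. Its pullback along `s` is -e, because pr ∘
  -- s = id and the relative cochain u vanishes on simplices lying in `B`.
  rw [AddSubgroup.mem_addSubgroupOf, ← neg_mem_iff]
  convert h2 using 1
  funext t
  have h3 : u.1 (s.comp t) = 0 := by
    refine u.2.1 _ ?_
    rintro _ ⟨y, rfl⟩
    exact hB _
  change -(e.1 t) = -(e.1 (pr.comp (s.comp t))) + u.1 ((ContinuousMap.id Y).comp (s.comp t))
  rw [← ContinuousMap.comp_assoc, hpr, ContinuousMap.id_comp, ContinuousMap.id_comp, h3, add_zero]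

end SingularCoh

namespace EulerClass

open SingularCoh

variable {M : Type*} [TopologicalSpace M]
  {F : Type*} [NormedAddCommGroup F] [NormedSpace ℝ F]
  {V : M → Type*} [TopologicalSpace (TotalSpace F V)]
  [∀ x, NormedAddCommGroup (V x)] [∀ x, NormedSpace ℝ (V x)]
  [FiberBundle F V] [VectorBundle ℝ F V]

/-- A continuous section of an oriented vector bundle with non-zero Euler class has a zero. -/
theorem exists_eq_zero_of_eulerClass_ne_zero (o : BundleOrientation F V) (h : eulerClass o ≠ 0)
    (σ : Π x : M, V x) (hσ : Continuous fun x : M => TotalSpace.mk' F x (σ x)) :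
    ∃ x, σ x = 0 := by
  by_contra! hne
  apply h
  by_cases hex : ∃ e, IsEulerClass o e
  · rw [eulerClass, dif_pos hex]
    obtain ⟨u, -, hu⟩ := hex.choose_spec
    exact eq_zero_of_pullback_eq_of_mapsTo (projection F V) ⟨_, hσ⟩ (fun x => rfl)
      (B := nonzeroVectors F V) hne _ u hu
  -- Without an Euler class the default value 0 applies, so neither existence nor uniqueness of the
  -- Thom class is needed.
  · rw [eulerClass, dif_neg hex]

end EulerClass

/-! ### Metric traces in moving frames; functions with zero differential -/

/-- The trace of a bilinear form with respect to the inner product, computed in an arbitrary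
basis. -/
theorem OrthonormalBasis.sum_bilin_eq_sum_inv_gram {W ι κ : Type*} [NormedAddCommGroup W]
    [InnerProductSpace ℝ W] [Fintype ι] [Fintype κ] [DecidableEq κ]
    (E : OrthonormalBasis ι ℝ W) (b : Module.Basis κ ℝ W) (Q : W →ₗ[ℝ] W →ₗ[ℝ] ℝ) :
    ∑ i, Q (E i) (E i) = ∑ k, ∑ l, (Matrix.gram ℝ b)⁻¹ k l * Q (b k) (b l) := by
  classical
  let P : Matrix κ ι ℝ := b.toMatrix E
  let S : Matrix ι κ ℝ := E.toBasis.toMatrix b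
  have hSP : S * P = 1 := by
    have h := E.toBasis.toMatrix_mul_toMatrix_flip b
    rwa [E.coe_toBasis] at h
  have hPS : P * S = 1 := by
    have h := b.toMatrix_mul_toMatrix_flip E.toBasis
    rwa [E.coe_toBasis] at h
  have hG : Matrix.gram ℝ b = S.transpose * S := by
    ext k l
    simp only [Matrix.gram_apply, Matrix.mul_apply, Matrix.transpose_apply, S,
      Module.Basis.toMatrix_apply, OrthonormalBasis.coe_toBasis_repr_apply,
      OrthonormalBasis.repr_apply_apply]
    rw [← E.sum_inner_mul_inner]
    exact Finset.sum_congr rfl fun i _ => by rw [real_inner_comm]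
  -- `S` and `P` are mutually inverse changes of basis, so G = SᵀS has inverse PPᵀ.
  have hinv : (Matrix.gram ℝ b)⁻¹ = P * P.transpose := by
    refine Matrix.inv_eq_left_inv ?_
    rw [hG, Matrix.mul_assoc, ← Matrix.mul_assoc P.transpose, ← Matrix.transpose_mul, hSP,
      Matrix.transpose_one, Matrix.one_mul, hPS]
  have hE : ∀ i, E i = ∑ k, P k i • b k := fun i => (b.sum_toMatrix_smul_self E i).symm
  rw [hinv]
  simp only [Matrix.mul_apply, Matrix.transpose_apply, Finset.sum_mul]
  have : ∀ i, Q (E i) (E i) = ∑ k, ∑ l, P k i * P l i * Q (b k) (b l) := by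
    intro i
    rw [hE i]
    simp only [map_sum, LinearMap.sum_apply, map_smul, LinearMap.smul_apply, smul_eq_mul]
    simp only [Finset.mul_sum]
    rw [Finset.sum_comm]
    exact Finset.sum_congr rfl fun k _ => Finset.sum_congr rfl fun l _ => by ring
  simp only [this]
  rw [Finset.sum_comm]
  exact Finset.sum_congr rfl fun k _ => Finset.sum_comm

/-- The metric trace of a continuous family of bilinear forms on the fibres of a Riemannian vector
bundle is continuous. -/
theorem continuousAt_sum_orthonormalBasis_bilin {EB : Type*} [NormedAddCommGroup EB]
    [NormedSpace ℝ EB] {HB : Type*} [TopologicalSpace HB] (I : ModelWithCorners ℝ EB HB)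
    {B : Type*} [TopologicalSpace B] [ChartedSpace HB B]
    {F : Type*} [NormedAddCommGroup F] [NormedSpace ℝ F] [FiniteDimensional ℝ F]
    {V : B → Type*} [TopologicalSpace (TotalSpace F V)]
    [∀ x, NormedAddCommGroup (V x)] [∀ x, InnerProductSpace ℝ (V x)]
    [FiberBundle F V] [VectorBundle ℝ F V] [ContMDiffVectorBundle ∞ F V I]
    [IsContMDiffRiemannianBundle I ∞ F V]
    {ι : B → Type*} [∀ x, Fintype (ι x)] (E : ∀ x, OrthonormalBasis (ι x) ℝ (V x))
    (Q : ∀ x, V x →ₗ[ℝ] V x →ₗ[ℝ] ℝ) (x₀ : B)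
    (hQ : ∀ s t : Π x, V x, ContinuousAt (fun x => TotalSpace.mk' F x (s x)) x₀ →
      ContinuousAt (fun x => TotalSpace.mk' F x (t x)) x₀ →
      ContinuousAt (fun x => Q x (s x) (t x)) x₀) :
    ContinuousAt (fun x => ∑ i, Q x (E x i) (E x i)) x₀ := by
  -- The bases `E x` need not vary continuously with x. The trace is therefore computed in a smooth
  -- local frame, through the inverse of its Gram matrix.
  let e := trivializationAt F V x₀
  let b := Module.finBasis ℝ F
  have hx₀ : x₀ ∈ e.baseSet := FiberBundle.mem_baseSet_trivializationAt' x₀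
  let s := fun k x => e.localFrame b k x
  have hs : ∀ k, ContMDiffAt I (I.prod 𝓘(ℝ, F)) ∞ (fun x => TotalSpace.mk' F x (s k x)) x₀ :=
    fun k => contMDiffAt_localFrame_of_mem ∞ e b k hx₀
  have hG : ContinuousAt (fun x => Matrix.gram ℝ fun k => s k x) x₀ :=
    continuousAt_pi.2 fun k => continuousAt_pi.2 fun l =>
      ((hs k).inner_bundle (hs l)).continuousAt
  have hbasis : ∀ x (hx : x ∈ e.baseSet), (fun k => s k x) = e.basisAt b hx := fun x hx => by
    ext k; exact e.localFrame_apply_of_mem_baseSet b hx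
  have hdet : (Matrix.gram ℝ fun k => s k x₀).det ≠ 0 := by
    rw [Matrix.det_gram_ne_zero_iff_linearIndependent, hbasis x₀ hx₀]
    exact (e.basisAt b hx₀).linearIndependent
  have hGinv : ContinuousAt (fun x => (Matrix.gram ℝ fun k => s k x)⁻¹) x₀ := by
    refine ContinuousAt.comp (g := fun A => A⁻¹) (continuousAt_matrix_inv _ ?_) hG
    rw [Ring.inverse_eq_inv']
    exact continuousAt_inv₀ hdet
  have hmain : ContinuousAt (fun x => ∑ k, ∑ l,
      (Matrix.gram ℝ fun k => s k x)⁻¹ k l * Q x (s k x) (s l x)) x₀ := by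
    refine tendsto_finsetSum _ fun k _ => tendsto_finsetSum _ fun l _ => ?_
    refine ContinuousAt.mul ?_ (hQ _ _ (hs k).continuousAt (hs l).continuousAt)
    exact continuousAt_pi.1 (continuousAt_pi.1 hGinv k) l
  refine hmain.congr ?_
  filter_upwards [e.open_baseSet.mem_nhds hx₀] with x hx
  rw [(E x).sum_bilin_eq_sum_inv_gram (e.basisAt b hx) (Q x)]
  simp only [← hbasis x hx]

/-- A function on a connected manifold without boundary with vanishing derivative is constant. -/
theorem eq_of_forall_mfderiv_eq_zero {E H M : Type*} [NormedAddCommGroup E] [NormedSpace ℝ E]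
    [TopologicalSpace H] (I : ModelWithCorners ℝ E H) [I.Boundaryless] [TopologicalSpace M]
    [ChartedSpace H M] [IsManifold I 1 M] [PreconnectedSpace M] {f : M → ℝ}
    (hf : MDifferentiable I 𝓘(ℝ, ℝ) f) (h : ∀ x, mfderiv I 𝓘(ℝ, ℝ) f x = 0) (x y : M) :
    f x = f y := by
  have hloc : IsLocallyConstant f := by
    rw [IsLocallyConstant.iff_eventually_eq]
    intro x
    have hopen : IsOpen (extChartAt I x).target := isOpen_extChartAt_target x
    -- A ball in the chart target supplies the convexity needed for the mean value argument.
    obtain ⟨r, hr, hball⟩ := Metric.isOpen_iff.1 hopen _ (mem_extChartAt_target x)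
    have hd : ∀ z ∈ (extChartAt I x).target,
        HasFDerivAt (f ∘ (extChartAt I x).symm) (0 : E →L[ℝ] ℝ) z := by
      intro z hz
      have h1 : MDifferentiableAt 𝓘(ℝ, E) I (extChartAt I x).symm z :=
        (mdifferentiableOn_extChartAt_symm (I := I) (x := x) z hz).mdifferentiableAt (hopen.mem_nhds hz)
      have h2 := (hf ((extChartAt I x).symm z)).hasMFDerivAt.comp z h1.hasMFDerivAt
      rw [h, ContinuousLinearMap.zero_comp] at h2
      exact h2.hasFDerivAt
    have hev : ∀ᶠ y in 𝓝 x, y ∈ (extChartAt I x).source ∧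
        extChartAt I x y ∈ Metric.ball (extChartAt I x x) r :=
      Filter.Eventually.and (extChartAt_source_mem_nhds x)
        ((continuousAt_extChartAt x).eventually (Metric.ball_mem_nhds _ hr))
    filter_upwards [hev] with y hy
    have hc := (convex_ball (extChartAt I x x) r).is_const_of_fderivWithin_eq_zero (𝕜 := ℝ)
      (f := f ∘ (extChartAt I x).symm)
      (fun z hz => (hd z (hball hz)).differentiableAt.differentiableWithinAt)
      (fun z hz => by
        rw [fderivWithin_of_isOpen Metric.isOpen_ball hz, (hd z (hball hz)).fderiv])
      hy.2 (Metric.mem_ball_self hr)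
    simpa only [Function.comp_apply, (extChartAt I x).left_inv hy.1, extChartAt_to_inv] using hc
  exact hloc.apply_eq_of_preconnectedSpace x y

/-! ### Finiteness and full support of the Riemannian volume -/

namespace RiemannianVolume

variable {n : ℕ} {M : Type*} [TopologicalSpace M] [ChartedSpace (EuclideanSpace ℝ (Fin n)) M]

theorem aemeasurable_extChartAt_symm [MeasurableSpace M] [BorelSpace M] (x₀ : M)
    (f : EuclideanSpace ℝ (Fin n) → ENNReal) :
    AEMeasurable (extChartAt (𝓡 n) x₀).symm
      ((volume.restrict (extChartAt (𝓡 n) x₀).target).withDensity f) :=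
  ((continuousOn_extChartAt_symm x₀).aemeasurable
    (isOpen_extChartAt_target x₀).measurableSet).mono_ac (withDensity_absolutelyContinuous _ _)

variable [IsManifold (𝓡 n) ∞ M]

theorem extChartAt_symm_mem_baseSet (x₀ : M) {y : EuclideanSpace ℝ (Fin n)}
    (hy : y ∈ (extChartAt (𝓡 n) x₀).target) : (extChartAt (𝓡 n) x₀).symm y ∈
      (trivializationAt (EuclideanSpace ℝ (Fin n)) (TangentSpace (𝓡 n)) x₀).baseSet := by
  have hx := (extChartAt (𝓡 n) x₀).map_target hy
  rw [extChartAt_source] at hx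
  simpa using! hx

/-- The coordinate vector fields of the preferred chart form the local frame of the tangent bundle
induced by the corresponding trivialization. -/
theorem mfderiv_extChartAt_symm_single (x₀ : M) {y : EuclideanSpace ℝ (Fin n)}
    (hy : y ∈ (extChartAt (𝓡 n) x₀).target) (i : Fin n) :
    mfderiv 𝓘(ℝ, EuclideanSpace ℝ (Fin n)) (𝓡 n) (extChartAt (𝓡 n) x₀).symm y
        (EuclideanSpace.single i (1 : ℝ)) =
      (trivializationAt (EuclideanSpace ℝ (Fin n)) (TangentSpace (𝓡 n)) x₀).localFrame
        (EuclideanSpace.basisFun (Fin n) ℝ).toBasis i ((extChartAt (𝓡 n) x₀).symm y) := by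
  have hx : (extChartAt (𝓡 n) x₀).symm y ∈ (chartAt (EuclideanSpace ℝ (Fin n)) x₀).source := by
    have := (extChartAt (𝓡 n) x₀).map_target hy
    rwa [extChartAt_source] at this
  have h := TangentBundle.symmL_trivializationAt (I := 𝓡 n) hx
  rw [ModelWithCorners.Boundaryless.range_eq_univ, mfderivWithin_univ,
    (extChartAt (𝓡 n) x₀).right_inv hy] at h
  rw [← h, Trivialization.localFrame_apply_of_mem_baseSet _ _ (by simpa using! hx)]
  rw [Trivialization.basisAt, Module.Basis.map_apply, OrthonormalBasis.coe_toBasis,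
    EuclideanSpace.basisFun_apply]
  exact Trivialization.symmL_apply (R := ℝ) (F := EuclideanSpace ℝ (Fin n))
    (trivializationAt (EuclideanSpace ℝ (Fin n)) (TangentSpace (𝓡 n)) x₀)
    (extChartAt_symm_mem_baseSet x₀ hy) (EuclideanSpace.single i (1 : ℝ))

theorem tsupport_chartPartition_subset [T2Space M] [SigmaCompactSpace M] (x₀ : M) :
    tsupport (chartPartition n M x₀) ⊆ (extChartAt (𝓡 n) x₀).source := by
  rw [extChartAt_source]
  exact (SmoothPartitionOfUnity.exists_isSubordinate_chartAt_source (𝓡 n) M).choose_spec x₀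

variable [RiemannianBundle (fun x : M => TangentSpace (𝓡 n) x)]

theorem chartDensity_eq_sqrt_det_gram (x₀ : M) {y : EuclideanSpace ℝ (Fin n)}
    (hy : y ∈ (extChartAt (𝓡 n) x₀).target) :
    chartDensity x₀ y = Real.sqrt (Matrix.gram ℝ fun i =>
      (trivializationAt (EuclideanSpace ℝ (Fin n)) (TangentSpace (𝓡 n)) x₀).localFrame
        (EuclideanSpace.basisFun (Fin n) ℝ).toBasis i ((extChartAt (𝓡 n) x₀).symm y)).det := by
  simp only [chartDensity, mfderiv_extChartAt_symm_single x₀ hy]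
  rfl

theorem chartDensity_pos (x₀ : M) {y : EuclideanSpace ℝ (Fin n)}
    (hy : y ∈ (extChartAt (𝓡 n) x₀).target) : 0 < chartDensity x₀ y := by
  have hx := extChartAt_symm_mem_baseSet x₀ hy
  rw [chartDensity_eq_sqrt_det_gram x₀ hy, Real.sqrt_pos]
  refine (Matrix.posDef_gram_of_linearIndependent ?_).det_pos
  convert! (Trivialization.basisAt _ (EuclideanSpace.basisFun (Fin n) ℝ).toBasis
    hx).linearIndependent using 1
  ext1 i
  exact Trivialization.localFrame_apply_of_mem_baseSet _ _ hx

theorem continuousOn_chartDensity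
    [IsContMDiffRiemannianBundle (𝓡 n) ∞ (EuclideanSpace ℝ (Fin n))
      (fun x : M => TangentSpace (𝓡 n) x)] (x₀ : M) :
    ContinuousOn (chartDensity (n := n) x₀) (extChartAt (𝓡 n) x₀).target := by
  refine ContinuousOn.congr ?_ fun y hy => chartDensity_eq_sqrt_det_gram x₀ hy
  refine Real.continuous_sqrt.comp_continuousOn ?_
  refine (continuous_id.matrix_det).comp_continuousOn ?_
  refine continuousOn_pi.2 fun i => continuousOn_pi.2 fun j => ?_
  have h : ∀ i, ContMDiffOn (𝓡 n) ((𝓡 n).prod 𝓘(ℝ, EuclideanSpace ℝ (Fin n))) ∞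
      (fun x : M => TotalSpace.mk' (EuclideanSpace ℝ (Fin n)) x
        ((trivializationAt (EuclideanSpace ℝ (Fin n)) (TangentSpace (𝓡 n)) x₀).localFrame
          (EuclideanSpace.basisFun (Fin n) ℝ).toBasis i x))
      (trivializationAt (EuclideanSpace ℝ (Fin n)) (TangentSpace (𝓡 n)) x₀).baseSet :=
    fun i => Trivialization.contMDiffOn_localFrame_baseSet _ _ _ i
  exact ((h i).inner_bundle (h j)).continuousOn.comp (continuousOn_extChartAt_symm x₀)
    fun y hy => extChartAt_symm_mem_baseSet x₀ hy

variable [IsContMDiffRiemannianBundle (𝓡 n) ∞ (EuclideanSpace ℝ (Fin n))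
      (fun x : M => TangentSpace (𝓡 n) x)]
  [T2Space M]

theorem continuousOn_chartPartition_mul_chartDensity [SigmaCompactSpace M] (x₀ : M) :
    ContinuousOn (fun y => chartPartition n M x₀ ((extChartAt (𝓡 n) x₀).symm y) *
      chartDensity x₀ y) (extChartAt (𝓡 n) x₀).target :=
  ((chartPartition n M x₀).contMDiff.continuous.comp_continuousOn
    (continuousOn_extChartAt_symm x₀)).mul (continuousOn_chartDensity x₀)

/-- The density may be unbounded on the whole chart target, but the partition function cuts it down
to a compact subset, where continuity bounds it. -/
theorem lintegral_chartPartition_mul_chartDensity_lt_top [CompactSpace M] (x₀ : M) :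
    ∫⁻ y in (extChartAt (𝓡 n) x₀).target, ENNReal.ofReal
      (chartPartition n M x₀ ((extChartAt (𝓡 n) x₀).symm y) * chartDensity x₀ y) < ⊤ := by
  let K := extChartAt (𝓡 n) x₀ '' tsupport (chartPartition n M x₀)
  have hKt : K ⊆ (extChartAt (𝓡 n) x₀).target := by
    rintro _ ⟨x, hx, rfl⟩
    exact (extChartAt (𝓡 n) x₀).map_source (tsupport_chartPartition_subset x₀ hx)
  have hK : IsCompact K :=
    (isClosed_tsupport _).isCompact.image_of_continuousOn
      ((continuousOn_extChartAt x₀).mono (tsupport_chartPartition_subset x₀))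
  obtain ⟨C, hC⟩ := hK.exists_bound_of_continuousOn
    ((continuousOn_chartPartition_mul_chartDensity x₀).mono hKt)
  calc _ ≤ ∫⁻ y in (extChartAt (𝓡 n) x₀).target, K.indicator (fun _ => ENNReal.ofReal C) y := by
        refine setLIntegral_mono' (isOpen_extChartAt_target x₀).measurableSet fun y hy => ?_
        by_cases hyK : y ∈ K
        · rw [Set.indicator_of_mem hyK]
          exact ENNReal.ofReal_le_ofReal ((le_abs_self _).trans (hC y hyK))
        · have h0 : chartPartition n M x₀ ((extChartAt (𝓡 n) x₀).symm y) = 0 := by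
            by_contra hne
            exact hyK ⟨_, subset_tsupport _ hne, (extChartAt (𝓡 n) x₀).right_inv hy⟩
          simp [h0, -extChartAt]
    _ ≤ ∫⁻ y, K.indicator (fun _ => ENNReal.ofReal C) y := setLIntegral_le_lintegral _ _
    _ = ENNReal.ofReal C * volume K := lintegral_indicator_const hK.measurableSet _
    _ < ⊤ := ENNReal.mul_lt_top ENNReal.ofReal_lt_top hK.measure_lt_top

instance isFiniteMeasure_riemannianVolume [CompactSpace M] [MeasurableSpace M] [BorelSpace M] :
    IsFiniteMeasure (riemannianVolume n M) where
  measure_univ_lt_top := by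
    have hfin : {x₀ : M | (Function.support (chartPartition n M x₀)).Nonempty}.Finite :=
      (chartPartition n M).locallyFinite.finite_nonempty_of_compact
    rw [riemannianVolume, Measure.sum_apply _ MeasurableSet.univ,
      tsum_eq_sum (s := hfin.toFinset)]
    · refine ENNReal.sum_lt_top.2 fun x₀ _ => ?_
      rw [Measure.map_apply_of_aemeasurable (aemeasurable_extChartAt_symm x₀ _)
        MeasurableSet.univ, Set.preimage_univ, withDensity_apply _ MeasurableSet.univ,
        Measure.restrict_univ]
      exact lintegral_chartPartition_mul_chartDensity_lt_top x₀
    · intro x₀ hx₀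
      have h0 : ∀ x, chartPartition n M x₀ x = 0 := by
        simpa [Set.Nonempty] using hx₀
      simp [h0, -extChartAt]

instance isOpenPosMeasure_riemannianVolume [SigmaCompactSpace M] [MeasurableSpace M]
    [BorelSpace M] : (riemannianVolume n M).IsOpenPosMeasure where
  open_pos U hU := by
    rintro ⟨x, hx⟩ h0
    obtain ⟨x₀, hx₀⟩ := (chartPartition n M).exists_pos_of_mem (Set.mem_univ x)
    let f := fun y => chartPartition n M x₀ ((extChartAt (𝓡 n) x₀).symm y) * chartDensity x₀ y
    have hcont : ContinuousOn f (extChartAt (𝓡 n) x₀).target :=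
      continuousOn_chartPartition_mul_chartDensity x₀
    have htarget : IsOpen (extChartAt (𝓡 n) x₀).target := isOpen_extChartAt_target x₀
    -- On `O` this single summand already has positive density, so a null `U` would give a non-empty
    -- open Lebesgue-null set `W`.
    let O := U ∩ {z | 0 < chartPartition n M x₀ z}
    have hO : IsOpen O :=
      hU.inter (isOpen_lt continuous_const (chartPartition n M x₀).contMDiff.continuous)
    let W := (extChartAt (𝓡 n) x₀).target ∩ (extChartAt (𝓡 n) x₀).symm ⁻¹' O
    have hW : IsOpen W := (continuousOn_extChartAt_symm x₀).isOpen_inter_preimage htarget hO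
    have hxs : x ∈ (extChartAt (𝓡 n) x₀).source :=
      tsupport_chartPartition_subset x₀ (subset_tsupport _ hx₀.ne')
    have hWne : W.Nonempty := by
      refine ⟨extChartAt (𝓡 n) x₀ x, (extChartAt (𝓡 n) x₀).map_source hxs, ?_⟩
      rw [Set.mem_preimage, (extChartAt (𝓡 n) x₀).left_inv hxs]
      exact ⟨hx, hx₀⟩
    rw [riemannianVolume, Measure.sum_apply _ hU.measurableSet, ENNReal.tsum_eq_zero] at h0
    have h1 : ((volume.restrict (extChartAt (𝓡 n) x₀).target).withDensity
        fun y => ENNReal.ofReal (f y)) W = 0 := by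
      refine le_antisymm ?_ bot_le
      rw [← h0 x₀]
      refine le_trans (measure_mono ?_)
        (Measure.le_map_apply (aemeasurable_extChartAt_symm x₀ _) U)
      exact fun y hy => hy.2.1
    rw [withDensity_apply _ hW.measurableSet, Measure.restrict_restrict hW.measurableSet,
      Set.inter_eq_left.2 (Set.inter_subset_left : W ⊆ _), lintegral_eq_zero_iff'
        ((hcont.mono Set.inter_subset_left).aemeasurable hW.measurableSet).ennreal_ofReal] at h1
    have h2 : ∀ᵐ y ∂(volume.restrict W), False := by
      filter_upwards [h1, ae_restrict_mem hW.measurableSet] with y hy hyW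
      have hpos : 0 < f y := mul_pos hyW.2.2 (chartDensity_pos x₀ hyW.1)
      exact hpos.not_ge (ENNReal.ofReal_eq_zero.1 hy)
    rw [Filter.eventually_false_iff_eq_bot, ae_eq_bot, Measure.restrict_eq_zero] at h2
    exact hW.measure_ne_zero volume hWne h2

end RiemannianVolume

/-! ### Differentiation under the integral; derivatives of rescaled sections -/

/-- The derivative is bounded on the compact set [t₀ - 1, t₀ + 1] × X, and a constant is an
integrable majorant for a finite measure. -/
theorem hasDerivAt_integral_of_continuous_deriv {X : Type*} [TopologicalSpace X] [CompactSpace X]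
    [MeasurableSpace X] [BorelSpace X] (μ : Measure X) [IsFiniteMeasure μ] {f f' : ℝ → X → ℝ}
    (hf : ∀ t, Continuous (f t)) (hf' : Continuous (Function.uncurry f'))
    (h : ∀ t x, HasDerivAt (fun s => f s x) (f' t x) t) (t₀ : ℝ) :
    HasDerivAt (fun t => ∫ x, f t x ∂μ) (∫ x, f' t₀ x ∂μ) t₀ := by
  obtain ⟨C, hC⟩ := ((isCompact_closedBall t₀ 1).prod isCompact_univ).exists_bound_of_continuousOn
    (hf'.continuousOn (s := Metric.closedBall t₀ 1 ×ˢ (Set.univ : Set X)))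
  have hint : ∀ g : X → ℝ, Continuous g → Integrable g μ := fun g hg =>
    (BoundedContinuousFunction.mkOfCompact ⟨g, hg⟩).integrable μ
  refine (hasDerivAt_integral_of_dominated_loc_of_deriv_le (bound := fun _ => C)
    (Metric.closedBall_mem_nhds t₀ one_pos)
    (Filter.Eventually.of_forall fun t => (hint _ (hf t)).aestronglyMeasurable) (hint _ (hf t₀))
    (hint _ (hf'.comp (Continuous.prodMk_right t₀))).aestronglyMeasurable
    (Filter.Eventually.of_forall fun x t ht => hC (t, x) ⟨ht, Set.mem_univ x⟩)
    (integrable_const C) (Filter.Eventually.of_forall fun x t _ => h t x)).2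

namespace CovariantDerivative

variable {E H M : Type*} [NormedAddCommGroup E] [NormedSpace ℝ E] [TopologicalSpace H]
  {I : ModelWithCorners ℝ E H} [TopologicalSpace M] [ChartedSpace H M]
  {F : Type*} [NormedAddCommGroup F] [NormedSpace ℝ F]
  {V : M → Type*} [TopologicalSpace (TotalSpace F V)]
  [∀ x, NormedAddCommGroup (V x)] [∀ x, InnerProductSpace ℝ (V x)]
  [FiberBundle F V] [VectorBundle ℝ F V] [IsContMDiffRiemannianBundle I 1 F V]
  {σ : Π x : M, V x} {x : M}

theorem mdifferentiableAt_norm_sq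
    (hσ : MDifferentiableAt I (I.prod 𝓘(ℝ, F)) (fun x => TotalSpace.mk' F x (σ x)) x) :
    MDifferentiableAt I 𝓘(ℝ, ℝ) (fun x => ‖σ x‖ ^ 2) x := by
  simpa only [real_inner_self_eq_norm_sq] using hσ.inner_bundle hσ

variable [FiniteDimensional ℝ F] [ContMDiffVectorBundle 1 F V I]
  {cov : CovariantDerivative I F V}

theorem mvfderiv_norm_sq_apply (hcov : cov.IsMetricCompatible)
    (hσ : MDifferentiableAt I (I.prod 𝓘(ℝ, F)) (fun x => TotalSpace.mk' F x (σ x)) x)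
    (v : TangentSpace I x) :
    mvfderiv I (fun x => ‖σ x‖ ^ 2) x v = 2 * inner ℝ (cov σ x v) (σ x) := by
  -- Any extension of `v` to a vector field will do, since only its value at `x` enters.
  have h := hcov.mvfderiv_inner_eq (fun y => (show TangentSpace I y from (show E from v))) hσ hσ
  simp only [real_inner_self_eq_norm_sq] at h
  refine h.trans ?_
  rw [real_inner_comm (cov σ x _) (σ x), two_mul]

/-- The covariant derivative of a section rescaled by a function of its own length. -/
theorem apply_comp_norm_sq_smul (hcov : cov.IsMetricCompatible)
    (hσ : MDifferentiableAt I (I.prod 𝓘(ℝ, F)) (fun x => TotalSpace.mk' F x (σ x)) x)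
    {h : ℝ → ℝ} {h' : ℝ} (hh : HasDerivAt h h' (‖σ x‖ ^ 2)) (v : TangentSpace I x) :
    cov (fun y => h (‖σ y‖ ^ 2) • σ y) x v =
      h (‖σ x‖ ^ 2) • cov σ x v + (2 * h' * inner ℝ (cov σ x v) (σ x)) • σ x := by
  have hu := mdifferentiableAt_norm_sq hσ
  have hg : MDifferentiableAt I 𝓘(ℝ, ℝ) (fun y => h (‖σ y‖ ^ 2)) x :=
    hh.differentiableAt.mdifferentiableAt.comp x hu
  have hl := cov.isCovariantDerivativeOn.leibniz (s := Set.univ) hσ hg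
  have hd : mvfderiv I (fun y => h (‖σ y‖ ^ 2)) x v = h' * mvfderiv I (fun y => ‖σ y‖ ^ 2) x v := by
    have h1 := hh.hasFDerivAt.hasMFDerivAt.comp x hu.hasMFDerivAt
    have h2 := h1.mfderiv
    simp only [mvfderiv, ContinuousLinearMap.comp_apply]
    change mfderiv I 𝓘(ℝ, ℝ) (h ∘ fun y => ‖σ y‖ ^ 2) x v = _
    rw [h2]
    exact mul_comm (mvfderiv I (fun y => ‖σ y‖ ^ 2) x v) h'
  have := congrArg (fun L => L v) hl
  refine this.trans ?_
  simp only [add_apply, smul_apply,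
    ContinuousLinearMap.smulRight_apply, hd, mvfderiv_norm_sq_apply hcov hσ]
  congr 2
  ring

end CovariantDerivative

/-- A smooth family of multiples of a smooth section is smooth. -/
theorem ContMDiff.smul_section_fst {E H M : Type*} [NormedAddCommGroup E] [NormedSpace ℝ E]
    [TopologicalSpace H]
    {I : ModelWithCorners ℝ E H} [TopologicalSpace M] [ChartedSpace H M]
    {F : Type*} [NormedAddCommGroup F] [NormedSpace ℝ F]
    {V : M → Type*} [TopologicalSpace (TotalSpace F V)]
    [∀ x, AddCommGroup (V x)] [∀ x, Module ℝ (V x)] [∀ x, TopologicalSpace (V x)]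
    [FiberBundle F V] [VectorBundle ℝ F V] {σ : Π x : M, V x} {f : M × ℝ → ℝ} {k : WithTop ℕ∞}
    (hf : ContMDiff (I.prod 𝓘(ℝ, ℝ)) 𝓘(ℝ, ℝ) k f)
    (hσ : ContMDiff I (I.prod 𝓘(ℝ, F)) k (fun x => TotalSpace.mk' F x (σ x))) :
    ContMDiff (I.prod 𝓘(ℝ, ℝ)) (I.prod 𝓘(ℝ, F)) k
      (fun z : M × ℝ => TotalSpace.mk' F z.1 (f z • σ z.1)) := by
  intro z
  rw [contMDiffAt_totalSpace]
  refine ⟨contMDiffAt_fst, ?_⟩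
  have h1 := (contMDiffAt_totalSpace.1 (hσ z.1)).2
  have h2 := (hf z).smul (h1.comp z (contMDiffAt_fst (I := I) (J := 𝓘(ℝ, ℝ)) (N := ℝ)))
  refine h2.congr_of_eventuallyEq ?_
  have hmem : ∀ᶠ w : M × ℝ in 𝓝 z, w.1 ∈ (trivializationAt F V z.1).baseSet :=
    continuousAt_fst.eventually ((trivializationAt F V z.1).open_baseSet.mem_nhds
      (FiberBundle.mem_baseSet_trivializationAt' z.1))
  filter_upwards [hmem] with w hw
  exact ((trivializationAt F V z.1).linear ℝ hw).map_smul (f w) (σ w.1)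

/-! ### Energy density along the rescaling variation -/

namespace PQHarmonic

/-- The energy density of the section `(1 + t φ(|σ|²)) σ` at a point with `u = |σ|²`,
`A = |∇σ|²`, `B = |⟨∇σ, σ⟩|²`, where `φ = (1 + u) ^ a` and `c = φ'(u)`. -/
noncomputable def rescaledDensity (p q φ c u A B t : ℝ) : ℝ :=
  (1 + (1 + t * φ) ^ 2 * u) ^ (-p) *
    ((1 + t * φ) ^ 2 * A + (4 * (1 + t * φ) * (t * c) + 4 * (t * c) ^ 2 * u) * B +
      q * ((1 + t * φ) * (1 + t * φ + 2 * (t * c) * u)) ^ 2 * B)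

/-- The derivative of `rescaledDensity` in `t`. -/
noncomputable def rescaledDensityDeriv (p q φ c u A B t : ℝ) : ℝ :=
  2 * φ * (1 + t * φ) * u * (-p) * (1 + (1 + t * φ) ^ 2 * u) ^ (-p - 1) *
    ((1 + t * φ) ^ 2 * A + (4 * (1 + t * φ) * (t * c) + 4 * (t * c) ^ 2 * u) * B +
      q * ((1 + t * φ) * (1 + t * φ + 2 * (t * c) * u)) ^ 2 * B) +
  (1 + (1 + t * φ) ^ 2 * u) ^ (-p) *
    (2 * φ * (1 + t * φ) * A + (4 * φ * (t * c) + 4 * (1 + t * φ) * c + 8 * t * c ^ 2 * u) * B +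
      q * (2 * ((1 + t * φ) * (1 + t * φ + 2 * (t * c) * u)) *
        (φ * (1 + t * φ + 2 * (t * c) * u) + (1 + t * φ) * (φ + 2 * c * u))) * B)

theorem continuous_rescaledDensity {X : Type*} [TopologicalSpace X] (p q : ℝ)
    {φ c u A B t : X → ℝ} (hφ : Continuous φ) (hc : Continuous c) (hu : Continuous u)
    (hA : Continuous A) (hB : Continuous B) (ht : Continuous t) (hu0 : ∀ x, 0 ≤ u x) :
    Continuous fun x => rescaledDensity p q (φ x) (c x) (u x) (A x) (B x) (t x) := by
  have hw : Continuous fun x => (1 + (1 + t x * φ x) ^ 2 * u x) ^ (-p) :=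
    Continuous.rpow_const (by fun_prop) fun x => Or.inl (by have := hu0 x; positivity)
  simp only [rescaledDensity]
  exact hw.mul (by fun_prop)

theorem continuous_rescaledDensityDeriv {X : Type*} [TopologicalSpace X] (p q : ℝ)
    {φ c u A B t : X → ℝ} (hφ : Continuous φ) (hc : Continuous c) (hu : Continuous u)
    (hA : Continuous A) (hB : Continuous B) (ht : Continuous t) (hu0 : ∀ x, 0 ≤ u x) :
    Continuous fun x => rescaledDensityDeriv p q (φ x) (c x) (u x) (A x) (B x) (t x) := by
  have hw : ∀ b : ℝ, Continuous fun x => (1 + (1 + t x * φ x) ^ 2 * u x) ^ b := fun b =>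
    Continuous.rpow_const (by fun_prop) fun x => Or.inl (by have := hu0 x; positivity)
  simp only [rescaledDensityDeriv]
  exact ((Continuous.mul (by fun_prop) (hw (-p - 1))).mul (by fun_prop)).add
    ((hw (-p)).mul (by fun_prop))

theorem hasDerivAt_rescaledDensity (p q φ c : ℝ) {u : ℝ} (hu : 0 ≤ u) (A B t : ℝ) :
    HasDerivAt (rescaledDensity p q φ c u A B) (rescaledDensityDeriv p q φ c u A B t) t := by
  have hl : HasDerivAt (fun t : ℝ => 1 + t * φ) φ t := by
    simpa using ((hasDerivAt_id t).mul_const φ).const_add 1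
  have hm : HasDerivAt (fun t : ℝ => t * c) c t := by
    simpa using (hasDerivAt_id t).mul_const c
  have hk : HasDerivAt (fun t : ℝ => 1 + t * φ + 2 * (t * c) * u) (φ + 2 * c * u) t :=
    hl.add ((hm.const_mul 2).mul_const u)
  have hw : HasDerivAt (fun t : ℝ => 1 + (1 + t * φ) ^ 2 * u) (2 * φ * (1 + t * φ) * u) t := by
    refine (((hl.pow 2).mul_const u).const_add 1).congr_deriv ?_
    simp only [Nat.cast_ofNat, Nat.reduceSub, pow_one]
    ring
  have hwpos : 1 + (1 + t * φ) ^ 2 * u ≠ 0 := by positivity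
  have hr := hw.rpow_const (p := -p) (Or.inl hwpos)
  have hP := (((hl.pow 2).mul_const A).add
    ((((hl.const_mul 4).mul hm).add (((hm.pow 2).const_mul 4).mul_const u)).mul_const B)).add
    ((((hl.mul hk).pow 2).const_mul q).mul_const B)
  refine (hr.mul hP).congr_deriv ?_
  simp only [rescaledDensityDeriv, Pi.mul_apply, Pi.pow_apply, Pi.add_apply,
    Nat.cast_ofNat, Nat.reduceSub, pow_one]
  ring

theorem rescaledDensityDeriv_zero (p q a : ℝ) {u : ℝ} (hu : 0 ≤ u) (A B : ℝ) :
    rescaledDensityDeriv p q ((1 + u) ^ a) (a * (1 + u) ^ (a - 1)) u A B 0 =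
      2 * ((1 + u) ^ (a - p - 1) *
        ((1 + (1 - p) * u) * A + (2 * a + 2 * q + q * (2 * a + 2 - p) * u) * B)) := by
  have h1 : (0 : ℝ) < 1 + u := by positivity
  -- Expressing all powers through (1 + u)^(a-1) and (1 + u)^(-p-1) leaves a polynomial identity.
  have e1 : (1 + u) ^ a = (1 + u) ^ (a - 1) * (1 + u) := by
    rw [Real.rpow_sub_one h1.ne', div_mul_cancel₀ _ h1.ne']
  have e2 : (1 + u) ^ (-p) = (1 + u) ^ (-p - 1) * (1 + u) := by
    rw [Real.rpow_sub_one h1.ne', div_mul_cancel₀ _ h1.ne']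
  have e3 : (1 + u) ^ (a - p - 1) = (1 + u) ^ (a - 1) * (1 + u) ^ (-p - 1) * (1 + u) := by
    rw [← Real.rpow_add h1, ← Real.rpow_add_one h1.ne']
    congr 1
    ring
  simp only [rescaledDensityDeriv, zero_mul, mul_zero, add_zero, one_pow, one_mul, mul_one]
  rw [e1, e2, e3]
  ring

theorem continuousAt_cov_apply {n : ℕ} {M : Type*} [TopologicalSpace M]
    [ChartedSpace (EuclideanSpace ℝ (Fin n)) M] [IsManifold (𝓡 n) ∞ M]
    {F : Type*} [NormedAddCommGroup F] [NormedSpace ℝ F]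
    {V : M → Type*} [TopologicalSpace (TotalSpace F V)]
    [∀ x, NormedAddCommGroup (V x)] [∀ x, InnerProductSpace ℝ (V x)]
    [FiberBundle F V] [VectorBundle ℝ F V] {cov : CovariantDerivative (𝓡 n) F V}
    [CovariantDerivative.ContMDiffCovariantDerivative cov ∞] {σ : Π x : M, V x}
    (hσ : ContMDiff (𝓡 n) ((𝓡 n).prod 𝓘(ℝ, F)) ∞ (fun x : M => TotalSpace.mk' F x (σ x)))
    {x₀ : M} {s : Π x : M, TangentSpace (𝓡 n) x}
    (hs : ContinuousAt (fun x => TotalSpace.mk' (EuclideanSpace ℝ (Fin n)) x (s x)) x₀) :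
    ContinuousAt (fun x => TotalSpace.mk' F x (cov σ x (s x))) x₀ := by
  have h := (CovariantDerivative.ContMDiffCovariantDerivative.contMDiff (cov := cov)
    (k := ∞)).contMDiff (σ := σ) (by simpa using! hσ.contMDiffOn)
  exact (contMDiffOn_univ.1 h).continuous.continuousAt.clm_bundle_apply hs

variable {n : ℕ} {M : Type*} [TopologicalSpace M] [ChartedSpace (EuclideanSpace ℝ (Fin n)) M]
  [RiemannianBundle (fun x : M => TangentSpace (𝓡 n) x)]

variable (n) in
/-- An orthonormal basis of the tangent space. -/
noncomputable def tangentBasis (x : M) :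
    OrthonormalBasis (Fin (Module.finrank ℝ (TangentSpace (𝓡 n) x))) ℝ (TangentSpace (𝓡 n) x) :=
  haveI : FiniteDimensional ℝ (TangentSpace (𝓡 n) x) :=
    inferInstanceAs (FiniteDimensional ℝ (EuclideanSpace ℝ (Fin n)))
  stdOrthonormalBasis ℝ (TangentSpace (𝓡 n) x)

variable {F : Type*} [NormedAddCommGroup F] [NormedSpace ℝ F]
  {V : M → Type*} [TopologicalSpace (TotalSpace F V)]
  [∀ x, NormedAddCommGroup (V x)] [∀ x, InnerProductSpace ℝ (V x)]
  [FiberBundle F V]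
  (cov : CovariantDerivative (𝓡 n) F V) (σ : Π x : M, V x)

/-- The squared norm `|∇σ|²` of the covariant derivative. -/
noncomputable def gradSq (x : M) : ℝ := ∑ i, ‖cov σ x (tangentBasis n x i)‖ ^ 2

/-- The squared norm `|⟨∇σ, σ⟩|²`. -/
noncomputable def radialGradSq (x : M) : ℝ :=
  ∑ i, inner ℝ (cov σ x (tangentBasis n x i)) (σ x) ^ 2

theorem gradSq_nonneg (x : M) : 0 ≤ gradSq cov σ x :=
  Finset.sum_nonneg fun _ _ => sq_nonneg _

theorem radialGradSq_nonneg (x : M) : 0 ≤ radialGradSq cov σ x :=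
  Finset.sum_nonneg fun _ _ => sq_nonneg _

/-- Cauchy–Schwarz in each direction. It passes the vanishing of |∇σ|² on to |⟨∇σ, σ⟩|². -/
theorem radialGradSq_le (x : M) : radialGradSq cov σ x ≤ ‖σ x‖ ^ 2 * gradSq cov σ x := by
  rw [radialGradSq, gradSq, Finset.mul_sum]
  refine Finset.sum_le_sum fun i _ => ?_
  rw [← mul_pow, mul_comm, ← sq_abs]
  exact pow_le_pow_left₀ (abs_nonneg _) (abs_real_inner_le_norm _ _) 2

variable {cov σ}

theorem inner_cov_eq_zero_of_radialGradSq_eq_zero {x : M} (h : radialGradSq cov σ x = 0)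
    (v : TangentSpace (𝓡 n) x) : inner ℝ (cov σ x v) (σ x) = 0 := by
  have hi : ∀ i, inner ℝ (cov σ x (tangentBasis n x i)) (σ x) = 0 := fun i =>
    pow_eq_zero_iff two_ne_zero |>.1
      ((Finset.sum_eq_zero_iff_of_nonneg fun _ _ => sq_nonneg _).1 h i (Finset.mem_univ i))
  rw [← (tangentBasis n x).sum_repr v, map_sum, sum_inner]
  refine Finset.sum_eq_zero fun i _ => ?_
  rw [map_smul, real_inner_smul_left, hi, mul_zero]

variable [VectorBundle ℝ F V] [IsContMDiffRiemannianBundle (𝓡 n) ∞ F V]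

section

variable [FiniteDimensional ℝ F] [ContMDiffVectorBundle ∞ F V (𝓡 n)]

/-- With h = 1 + tφ and c = φ'(u), the derivative of hσ is h∇σ + 2tc⟨∇σ, σ⟩σ; hence only u, |∇σ|²
and |⟨∇σ, σ⟩|² enter. -/
theorem verticalEnergyDensity_rescaled (hcov : cov.IsMetricCompatible)
    (hσ : ContMDiff (𝓡 n) ((𝓡 n).prod 𝓘(ℝ, F)) ∞ (fun x : M => TotalSpace.mk' F x (σ x)))
    (p q a t : ℝ) (x : M) :
    verticalEnergyDensity cov p q (fun y => (1 + t * (1 + ‖σ y‖ ^ 2) ^ a) • σ y) x =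
      rescaledDensity p q ((1 + ‖σ x‖ ^ 2) ^ a) (a * (1 + ‖σ x‖ ^ 2) ^ (a - 1)) (‖σ x‖ ^ 2)
        (gradSq cov σ x) (radialGradSq cov σ x) t := by
  have hpos : (0 : ℝ) < 1 + ‖σ x‖ ^ 2 := by positivity
  have hh : HasDerivAt (fun u : ℝ => 1 + t * (1 + u) ^ a)
      (t * (a * (1 + ‖σ x‖ ^ 2) ^ (a - 1))) (‖σ x‖ ^ 2) := by
    have := ((((hasDerivAt_id (‖σ x‖ ^ 2)).const_add 1).rpow_const (p := a)
      (Or.inl hpos.ne')).const_mul t).const_add 1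
    simpa using this
  have hd := fun v => CovariantDerivative.apply_comp_norm_sq_smul hcov
    (hσ.mdifferentiable (by simp) x) hh v
  set φ := (1 + ‖σ x‖ ^ 2) ^ a with hφ
  set c := a * (1 + ‖σ x‖ ^ 2) ^ (a - 1) with hc
  change ∑ i, verticalMetric p q _ (cov _ x (tangentBasis n x i)) (cov _ x (tangentBasis n x i)) = _
  simp only [hd, verticalMetric]
  rw [rescaledDensity, gradSq, radialGradSq, ← Finset.mul_sum]
  have hw : (1 / (1 + ‖(1 + t * φ) • σ x‖ ^ 2)) ^ p = (1 + (1 + t * φ) ^ 2 * ‖σ x‖ ^ 2) ^ (-p) := by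
    rw [norm_smul, mul_pow, Real.norm_eq_abs, sq_abs, one_div, Real.inv_rpow (by positivity),
      Real.rpow_neg (by positivity)]
  rw [hw]
  congr 1
  rw [Finset.mul_sum, Finset.mul_sum, Finset.mul_sum, ← Finset.sum_add_distrib,
    ← Finset.sum_add_distrib]
  refine Finset.sum_congr rfl fun i _ => ?_
  generalize cov σ x (tangentBasis n x i) = w
  simp only [← hφ, inner_add_left, inner_add_right, real_inner_smul_left, real_inner_smul_right,
    real_inner_comm w (σ x)]
  simp only [real_inner_self_eq_norm_sq]
  ring

end

variable [IsManifold (𝓡 n) ∞ M]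
  [IsContMDiffRiemannianBundle (𝓡 n) ∞ (EuclideanSpace ℝ (Fin n))
      (fun x : M => TangentSpace (𝓡 n) x)]
  [CovariantDerivative.ContMDiffCovariantDerivative cov ∞]

theorem continuous_gradSq
    (hσ : ContMDiff (𝓡 n) ((𝓡 n).prod 𝓘(ℝ, F)) ∞ (fun x : M => TotalSpace.mk' F x (σ x))) :
    Continuous (gradSq cov σ) := by
  have : IsContinuousRiemannianBundle F V := by
    obtain ⟨g, hg, h⟩ :=
      IsContMDiffRiemannianBundle.exists_contMDiff (IB := 𝓡 n) (n := ∞) (F := F) (E := V)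
    exact ⟨g, hg.continuous, h⟩
  rw [continuous_iff_continuousAt]
  intro x₀
  have h := continuousAt_sum_orthonormalBasis_bilin (𝓡 n) (F := EuclideanSpace ℝ (Fin n))
    (V := fun x : M => TangentSpace (𝓡 n) x) (tangentBasis n)
    (fun x => (innerₗ (V x)).compl₁₂ (cov σ x).toLinearMap (cov σ x).toLinearMap) x₀
    (fun s t hs ht => (continuousAt_cov_apply hσ hs).inner_bundle (continuousAt_cov_apply hσ ht))
  refine h.congr (Filter.Eventually.of_forall fun x => ?_)
  exact Finset.sum_congr rfl fun i _ => real_inner_self_eq_norm_sq _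

theorem continuous_radialGradSq
    (hσ : ContMDiff (𝓡 n) ((𝓡 n).prod 𝓘(ℝ, F)) ∞ (fun x : M => TotalSpace.mk' F x (σ x))) :
    Continuous (radialGradSq cov σ) := by
  have : IsContinuousRiemannianBundle F V := by
    obtain ⟨g, hg, h⟩ :=
      IsContMDiffRiemannianBundle.exists_contMDiff (IB := 𝓡 n) (n := ∞) (F := F) (E := V)
    exact ⟨g, hg.continuous, h⟩
  rw [continuous_iff_continuousAt]
  intro x₀
  have hl : ∀ s : Π x : M, TangentSpace (𝓡 n) x,
      ContinuousAt (fun x => TotalSpace.mk' (EuclideanSpace ℝ (Fin n)) x (s x)) x₀ →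
      ContinuousAt (fun x => inner ℝ (σ x) (cov σ x (s x))) x₀ := fun s hs =>
    hσ.continuous.continuousAt.inner_bundle (continuousAt_cov_apply hσ hs)
  have h := continuousAt_sum_orthonormalBasis_bilin (𝓡 n) (F := EuclideanSpace ℝ (Fin n))
    (V := fun x : M => TangentSpace (𝓡 n) x) (tangentBasis n)
    (fun x => (LinearMap.mul ℝ ℝ).compl₁₂ ((innerₗ (V x) (σ x)).comp (cov σ x).toLinearMap)
      ((innerₗ (V x) (σ x)).comp (cov σ x).toLinearMap)) x₀
    (fun s t hs ht => (hl s hs).mul (hl t ht))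
  refine h.congr (Filter.Eventually.of_forall fun x => ?_)
  refine Finset.sum_congr rfl fun i _ => ?_
  rw [sq, real_inner_comm]
  rfl

end PQHarmonic

/-! ### First variation formula and its consequences -/

namespace PQHarmonic

theorem continuous_norm_sq {E H M : Type*} [NormedAddCommGroup E] [NormedSpace ℝ E]
    [TopologicalSpace H] {I : ModelWithCorners ℝ E H} [TopologicalSpace M] [ChartedSpace H M]
    {F : Type*} [NormedAddCommGroup F] [NormedSpace ℝ F]
    {V : M → Type*} [TopologicalSpace (TotalSpace F V)]
    [∀ x, NormedAddCommGroup (V x)] [∀ x, InnerProductSpace ℝ (V x)]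
    [FiberBundle F V] [VectorBundle ℝ F V] [IsContMDiffRiemannianBundle I ∞ F V]
    {σ : Π x : M, V x}
    (hσ : ContMDiff I (I.prod 𝓘(ℝ, F)) ∞ (fun x : M => TotalSpace.mk' F x (σ x))) :
    Continuous fun x => ‖σ x‖ ^ 2 := by
  simpa only [real_inner_self_eq_norm_sq] using (hσ.inner_bundle hσ).continuous

variable {n : ℕ} {M : Type*} [TopologicalSpace M] [ChartedSpace (EuclideanSpace ℝ (Fin n)) M]
  [IsManifold (𝓡 n) ∞ M]
  [RiemannianBundle (fun x : M => TangentSpace (𝓡 n) x)]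
  {F : Type*} [NormedAddCommGroup F] [NormedSpace ℝ F]
  {V : M → Type*} [TopologicalSpace (TotalSpace F V)]
  [∀ x, NormedAddCommGroup (V x)] [∀ x, InnerProductSpace ℝ (V x)]
  [FiberBundle F V] [VectorBundle ℝ F V]
  [IsContMDiffRiemannianBundle (𝓡 n) ∞ F V]
  {cov : CovariantDerivative (𝓡 n) F V} {σ : Π x : M, V x}

section

variable [IsContMDiffRiemannianBundle (𝓡 n) ∞ (EuclideanSpace ℝ (Fin n))
      (fun x : M => TangentSpace (𝓡 n) x)]
  [CovariantDerivative.ContMDiffCovariantDerivative cov ∞]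

variable (cov σ) in
/-- The integrand of the first variation of the vertical energy in the direction
`(1 + |σ|²) ^ a • σ`. -/
noncomputable def variationDensity (p q a : ℝ) (x : M) : ℝ :=
  (1 + ‖σ x‖ ^ 2) ^ (a - p - 1) * ((1 + (1 - p) * ‖σ x‖ ^ 2) * gradSq cov σ x +
    (2 * a + 2 * q + q * (2 * a + 2 - p) * ‖σ x‖ ^ 2) * radialGradSq cov σ x)

theorem continuous_variationDensity
    (hσ : ContMDiff (𝓡 n) ((𝓡 n).prod 𝓘(ℝ, F)) ∞ (fun x : M => TotalSpace.mk' F x (σ x)))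
    (p q a : ℝ) : Continuous (variationDensity cov σ p q a) := by
  have hu := continuous_norm_sq hσ
  refine ((continuous_const.add hu).rpow_const fun x => Or.inl ?_).mul
    (((continuous_const.add (continuous_const.mul hu)).mul (continuous_gradSq hσ)).add
      ((continuous_const.add (continuous_const.mul hu)).mul (continuous_radialGradSq hσ)))
  have : (0 : ℝ) < 1 + ‖σ x‖ ^ 2 := by positivity
  exact this.ne'

end

variable [FiniteDimensional ℝ F] [ContMDiffVectorBundle ∞ F V (𝓡 n)]

/-- If the differential of `|σ|²` vanishes wherever the non-negative function `1 + c |σ|²` does not,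
a section with a zero vanishes identically. -/
theorem eq_zero_of_mul_radialGradSq_eq_zero [PreconnectedSpace M] (hcov : cov.IsMetricCompatible)
    (hσ : ContMDiff (𝓡 n) ((𝓡 n).prod 𝓘(ℝ, F)) ∞ (fun x : M => TotalSpace.mk' F x (σ x)))
    {c : ℝ} (hc : ∀ x, 0 ≤ 1 + c * ‖σ x‖ ^ 2)
    (h : ∀ x, (1 + c * ‖σ x‖ ^ 2) * radialGradSq cov σ x = 0) {x₀ : M} (hx₀ : σ x₀ = 0) (x : M) :
    σ x = 0 := by
  have hu : ∀ x, MDifferentiableAt (𝓡 n) 𝓘(ℝ, ℝ) (fun x => ‖σ x‖ ^ 2) x := fun x =>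
    CovariantDerivative.mdifferentiableAt_norm_sq (hσ.mdifferentiable (by simp) x)
  -- The primitive u + cu²/2 is used because 1 + cu may vanish at some points, where du = 0 cannot
  -- be inferred.
  have hk : ∀ u : ℝ, HasDerivAt (fun u : ℝ => u + c * u ^ 2 / 2) (1 + c * u) u := fun u => by
    refine ((hasDerivAt_id u).add ((((hasDerivAt_id u).pow 2).const_mul c).div_const 2)).congr_deriv
      ?_
    simp only [id, Nat.cast_ofNat, Nat.reduceSub, pow_one]
    ring
  have hconst := eq_of_forall_mfderiv_eq_zero (𝓡 n)
    (f := fun x => ‖σ x‖ ^ 2 + c * (‖σ x‖ ^ 2) ^ 2 / 2)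
    (fun x => (hk _).differentiableAt.mdifferentiableAt.comp x (hu x))
    (fun x => by
      have h1 := ((hk (‖σ x‖ ^ 2)).hasFDerivAt.hasMFDerivAt.comp x (hu x).hasMFDerivAt).mfderiv
      refine h1.trans ?_
      ext v
      change mvfderiv (𝓡 n) (fun y => ‖σ y‖ ^ 2) x v * (1 + c * ‖σ x‖ ^ 2) = 0
      rw [CovariantDerivative.mvfderiv_norm_sq_apply hcov (hσ.mdifferentiable (by simp) x)]
      rcases mul_eq_zero.1 (h x) with h0 | h0
      · rw [h0, mul_zero]
      · rw [inner_cov_eq_zero_of_radialGradSq_eq_zero h0, mul_zero, zero_mul])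
    x x₀
  simp only [hx₀, norm_zero] at hconst
  have hfac : ‖σ x‖ ^ 2 * (1 + c * ‖σ x‖ ^ 2 / 2) = 0 := by linear_combination hconst
  -- This is half of 1 + (1 + cu), hence at least 1/2.
  have hpos : 0 < 1 + c * ‖σ x‖ ^ 2 / 2 := by linarith [hc x]
  simpa using (mul_eq_zero.1 hfac).resolve_right hpos.ne'

variable [IsContMDiffRiemannianBundle (𝓡 n) ∞ (EuclideanSpace ℝ (Fin n))
      (fun x : M => TangentSpace (𝓡 n) x)]
  [CovariantDerivative.ContMDiffCovariantDerivative cov ∞]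

variable [T2Space M] [CompactSpace M] [MeasurableSpace M] [BorelSpace M]

/-- The first variation formula for the vertical energy in the direction `(1 + |σ|²) ^ a • σ`. -/
theorem IsPQHarmonic.integral_variationDensity_eq_zero {p q : ℝ} (h : IsPQHarmonic cov p q σ)
    (hcov : cov.IsMetricCompatible)
    (hσ : ContMDiff (𝓡 n) ((𝓡 n).prod 𝓘(ℝ, F)) ∞ (fun x : M => TotalSpace.mk' F x (σ x)))
    (a : ℝ) : ∫ x, variationDensity cov σ p q a x ∂(RiemannianVolume.riemannianVolume n M) = 0 := by
  have hu := continuous_norm_sq hσ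
  have hA := continuous_gradSq (cov := cov) hσ
  have hB := continuous_radialGradSq (cov := cov) hσ
  have hpow : ∀ b : ℝ, Continuous fun x => (1 + ‖σ x‖ ^ 2) ^ b := fun b =>
    (continuous_const.add hu).rpow_const fun x =>
      Or.inl (ne_of_gt (show (0 : ℝ) < 1 + ‖σ x‖ ^ 2 by positivity))
  let G : ℝ → M → ℝ := fun t x =>
    rescaledDensity p q ((1 + ‖σ x‖ ^ 2) ^ a) (a * (1 + ‖σ x‖ ^ 2) ^ (a - 1)) (‖σ x‖ ^ 2)
      (gradSq cov σ x) (radialGradSq cov σ x) t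
  let G' : ℝ → M → ℝ := fun t x =>
    rescaledDensityDeriv p q ((1 + ‖σ x‖ ^ 2) ^ a) (a * (1 + ‖σ x‖ ^ 2) ^ (a - 1)) (‖σ x‖ ^ 2)
      (gradSq cov σ x) (radialGradSq cov σ x) t
  have hG : ∀ t, Continuous (G t) := fun t =>
    continuous_rescaledDensity p q (hpow a) (continuous_const.mul (hpow (a - 1))) hu hA hB
      continuous_const fun x => sq_nonneg _
  have hs : Continuous (Prod.snd : ℝ × M → M) := continuous_snd
  have hG' : Continuous (Function.uncurry G') :=
    continuous_rescaledDensityDeriv p q ((hpow a).comp hs)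
      (continuous_const.mul ((hpow (a - 1)).comp hs)) (hu.comp hs) (hA.comp hs) (hB.comp hs)
      continuous_fst fun x => sq_nonneg _
  have hderiv := (hasDerivAt_integral_of_continuous_deriv
    (RiemannianVolume.riemannianVolume n M) hG hG'
    (fun t x => hasDerivAt_rescaledDensity p q _ _ (sq_nonneg ‖σ x‖) _ _ t) 0).const_mul (1 / 2 : ℝ)
  have hS := h (fun t y => (1 + t * (1 + ‖σ y‖ ^ 2) ^ a) • σ y) ?_ (by simp)
  · simp only [verticalEnergy, verticalEnergyDensity_rescaled hcov hσ] at hS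
    have huniq := hS.unique hderiv
    simp only [G', rescaledDensityDeriv_zero p q a (sq_nonneg _), integral_const_mul] at huniq
    simp only [variationDensity]
    linarith
  · refine ContMDiff.smul_section_fst (f := fun z : M × ℝ => 1 + z.2 * (1 + ‖σ z.1‖ ^ 2) ^ a) ?_ hσ
    have hus : ContMDiff (𝓡 n) 𝓘(ℝ, ℝ) ∞ fun x => ‖σ x‖ ^ 2 := by
      simpa only [real_inner_self_eq_norm_sq] using hσ.inner_bundle hσ
    have hps : ContMDiff (𝓡 n) 𝓘(ℝ, ℝ) ∞ fun x => (1 + ‖σ x‖ ^ 2) ^ a := by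
      intro x
      have hpos : (1 : ℝ) + ‖σ x‖ ^ 2 ≠ 0 := by positivity
      exact ((contDiffAt_const.add contDiffAt_id).rpow_const_of_ne
        hpos).contMDiffAt.comp x (hus x) (f := fun x => ‖σ x‖ ^ 2)
        (g := fun u : ℝ => (1 + u) ^ a)
    exact contMDiff_const.add (contMDiff_snd.mul (hps.comp contMDiff_fst))

/-- A harmonic section whose first variation density is non-negative has vanishing density. -/
theorem IsPQHarmonic.variationDensity_eq_zero {p q : ℝ} (h : IsPQHarmonic cov p q σ)
    (hcov : cov.IsMetricCompatible)
    (hσ : ContMDiff (𝓡 n) ((𝓡 n).prod 𝓘(ℝ, F)) ∞ (fun x : M => TotalSpace.mk' F x (σ x)))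
    (a : ℝ) (hnonneg : ∀ x, 0 ≤ variationDensity cov σ p q a x) (x : M) :
    variationDensity cov σ p q a x = 0 := by
  have hcont := continuous_variationDensity (cov := cov) hσ p q a
  have hint : Integrable (variationDensity cov σ p q a) (RiemannianVolume.riemannianVolume n M) :=
    (BoundedContinuousFunction.mkOfCompact ⟨_, hcont⟩).integrable _
  have h0 := (integral_eq_zero_iff_of_nonneg hnonneg hint).1
    (h.integral_variationDensity_eq_zero hcov hσ a)
  -- Continuity and full support of the volume upgrade almost everywhere to everywhere.
  exact congrFun (Measure.eq_of_ae_eq h0 hcont continuous_const) x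

/-- If a section is `(p, q)`-harmonic for two values of `q`, then its length has vanishing
differential. -/
theorem IsPQHarmonic.radialGradSq_eq_zero_of_ne {p q q' : ℝ} (h : IsPQHarmonic cov p q σ)
    (h' : IsPQHarmonic cov p q' σ) (hne : q ≠ q') (hcov : cov.IsMetricCompatible)
    (hσ : ContMDiff (𝓡 n) ((𝓡 n).prod 𝓘(ℝ, F)) ∞ (fun x : M => TotalSpace.mk' F x (σ x)))
    (x : M) : radialGradSq cov σ x = 0 := by
  have hpos : ∀ x, (0 : ℝ) < 1 + ‖σ x‖ ^ 2 := fun x => by positivity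
  let w : M → ℝ := fun x => (1 + ‖σ x‖ ^ 2) ^ (p / 2 - 1 - p - 1) * radialGradSq cov σ x
  have hw : Continuous w :=
    ((continuous_const.add (continuous_norm_sq hσ)).rpow_const fun x => Or.inl (hpos x).ne').mul
      (continuous_radialGradSq hσ)
  have hint : ∀ f : M → ℝ, Continuous f →
      Integrable f (RiemannianVolume.riemannianVolume n M) := fun f hf =>
    (BoundedContinuousFunction.mkOfCompact ⟨f, hf⟩).integrable _
  -- For a = p/2 - 1 the factor 2a + 2 - p is zero, so q enters only through the term 2q.
  have hsplit : ∀ x, variationDensity cov σ p q (p / 2 - 1) x =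
      variationDensity cov σ p q' (p / 2 - 1) x + 2 * (q - q') * w x := fun x => by
    simp only [variationDensity, w]
    ring
  have h0 := h.integral_variationDensity_eq_zero hcov hσ (p / 2 - 1)
  simp only [hsplit] at h0
  rw [integral_add (hint _ (continuous_variationDensity hσ _ _ _))
    ((hint w hw).const_mul _), h'.integral_variationDensity_eq_zero hcov hσ, zero_add,
    integral_const_mul] at h0
  have h1 := (mul_eq_zero.1 h0).resolve_left (mul_ne_zero two_ne_zero (sub_ne_zero.2 hne))
  have hw0 : 0 ≤ w := fun x =>
    mul_nonneg (Real.rpow_nonneg (hpos x).le _) (radialGradSq_nonneg cov σ x)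
  have h2 := congrFun (Measure.eq_of_ae_eq
    ((integral_eq_zero_iff_of_nonneg hw0 (hint w hw)).1 h1) hw continuous_const) x
  exact (mul_eq_zero.1 h2).resolve_left (Real.rpow_pos_of_pos (hpos x) _).ne'

end PQHarmonic

/-! ### Choice of exponents and conclusion -/

theorem theoremB
    {n : ℕ} {M : Type*} [TopologicalSpace M] [ChartedSpace (EuclideanSpace ℝ (Fin n)) M]
    [IsManifold (𝓡 n) ∞ M] [T2Space M] [CompactSpace M] [ConnectedSpace M]
    [MeasurableSpace M] [BorelSpace M]
    [RiemannianBundle (fun x : M => TangentSpace (𝓡 n) x)]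
    [IsContMDiffRiemannianBundle (𝓡 n) ∞ (EuclideanSpace ℝ (Fin n))
      (fun x : M => TangentSpace (𝓡 n) x)]
    {F : Type*} [NormedAddCommGroup F] [NormedSpace ℝ F] [FiniteDimensional ℝ F]
    {V : M → Type*} [TopologicalSpace (TotalSpace F V)]
    [∀ x, NormedAddCommGroup (V x)] [∀ x, InnerProductSpace ℝ (V x)]
    [FiberBundle F V] [VectorBundle ℝ F V] [ContMDiffVectorBundle ∞ F V (𝓡 n)]
    [IsContMDiffRiemannianBundle (𝓡 n) ∞ F V]
    (cov : CovariantDerivative (𝓡 n) F V) [CovariantDerivative.ContMDiffCovariantDerivative cov ∞]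
    (hcov : cov.IsMetricCompatible)
    (o : EulerClass.BundleOrientation F V) (hχ : EulerClass.eulerClass o ≠ 0)
    (σ : Π x : M, V x)
    (hσ : ContMDiff (𝓡 n) ((𝓡 n).prod 𝓘(ℝ, F)) ∞ (fun x : M => TotalSpace.mk' F x (σ x)))
    (hσ0 : ∃ x, σ x ≠ 0) :
    (∀ p q q' : ℝ, PQHarmonic.IsPQHarmonic cov p q σ → PQHarmonic.IsPQHarmonic cov p q' σ →
      q = q') ∧
    ∀ p q : ℝ, PQHarmonic.IsPQHarmonic cov p q σ →
      (-4 ≤ p → p ≤ -1 → q < -1 - p) ∧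
      (-1 ≤ p → p ≤ 1 → q < 0) ∧
      (1 < p → p ≤ 2 → (⨆ x, ‖σ x‖) ≤ 1 / Real.sqrt (p - 1) → q < 0) ∧
      (2 ≤ p → (⨆ x, ‖σ x‖) ≤ 1 / Real.sqrt (p - 1) → q < 1 - p / 2) := by
  have hcont : Continuous fun x : M => TotalSpace.mk' F x (σ x) := hσ.continuous
  obtain ⟨z, hz⟩ := EulerClass.exists_eq_zero_of_eulerClass_ne_zero o hχ σ hcont
  obtain ⟨y, hy⟩ := hσ0
  have hvanish : ∀ c : ℝ, (∀ x, 0 ≤ 1 + c * ‖σ x‖ ^ 2) →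
      (∀ x, (1 + c * ‖σ x‖ ^ 2) * PQHarmonic.radialGradSq cov σ x = 0) → False :=
    fun c hc h => hy (PQHarmonic.eq_zero_of_mul_radialGradSq_eq_zero hcov hσ hc h hz y)
  have hA := PQHarmonic.gradSq_nonneg cov σ
  have hB := PQHarmonic.radialGradSq_nonneg cov σ
  have hpow : ∀ (b : ℝ) (x : M), 0 < (1 + ‖σ x‖ ^ 2) ^ b := fun b x =>
    Real.rpow_pos_of_pos (by positivity) b
  -- The last two conditions make both coefficients of 2a + 2q + q(2a + 2 - p)u non-negative,
  -- whatever the size of u.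
  have hexcl : ∀ p q a : ℝ, PQHarmonic.IsPQHarmonic cov p q σ →
      (∀ x, 0 ≤ 1 + (1 - p) * ‖σ x‖ ^ 2) → 0 ≤ 2 * a + 2 * q → 0 ≤ q * (2 * a + 2 - p) →
      False := by
    intro p q a h hc h1 h2
    have hnn1 : ∀ x, 0 ≤ (1 + (1 - p) * ‖σ x‖ ^ 2) * PQHarmonic.gradSq cov σ x :=
      fun x => mul_nonneg (hc x) (hA x)
    have hnn2 : ∀ x, 0 ≤ (2 * a + 2 * q + q * (2 * a + 2 - p) * ‖σ x‖ ^ 2) *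
        PQHarmonic.radialGradSq cov σ x :=
      fun x => mul_nonneg (add_nonneg h1 (mul_nonneg h2 (sq_nonneg _))) (hB x)
    have h0 := h.variationDensity_eq_zero hcov hσ a
      fun x => mul_nonneg (hpow _ x).le (add_nonneg (hnn1 x) (hnn2 x))
    refine hvanish (1 - p) hc fun x => ?_
    have hsum := (mul_eq_zero.1 (h0 x)).resolve_left (hpow _ x).ne'
    have hgrad : (1 + (1 - p) * ‖σ x‖ ^ 2) * PQHarmonic.gradSq cov σ x = 0 := by
      linarith [hnn1 x, hnn2 x]
    rcases mul_eq_zero.1 hgrad with h3 | h3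
    · rw [h3, zero_mul]
    · have hle := PQHarmonic.radialGradSq_le cov σ x
      rw [h3, mul_zero] at hle
      rw [le_antisymm hle (hB x), mul_zero]
  have hneg : ∀ p q : ℝ, PQHarmonic.IsPQHarmonic cov p q σ → p ≤ 2 →
      (∀ x, 0 ≤ 1 + (1 - p) * ‖σ x‖ ^ 2) → q < 0 := by
    intro p q h hp hc
    by_contra! hq
    exact hexcl p q 0 h hc (by linarith) (mul_nonneg hq (by linarith))
  have hsmall : ∀ p : ℝ, p ≤ 1 → ∀ x, 0 ≤ 1 + (1 - p) * ‖σ x‖ ^ 2 := fun p hp x =>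
    add_nonneg zero_le_one (mul_nonneg (by linarith) (sq_nonneg _))
  have hnorm : Continuous fun x => ‖σ x‖ := by
    simpa only [Function.comp_def, Real.sqrt_sq (norm_nonneg _)] using
      Real.continuous_sqrt.comp (PQHarmonic.continuous_norm_sq hσ)
  have hsup : ∀ p : ℝ, 1 < p → (⨆ x, ‖σ x‖) ≤ 1 / Real.sqrt (p - 1) →
      ∀ x, 0 ≤ 1 + (1 - p) * ‖σ x‖ ^ 2 := by
    intro p hp hle x
    -- Compactness is essential here: an unbounded family would have supremum 0 by convention.
    have hx : ‖σ x‖ ≤ 1 / Real.sqrt (p - 1) :=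
      (le_ciSup (isCompact_range hnorm).bddAbove x).trans hle
    have hs : 0 < p - 1 := by linarith
    have h1 : ‖σ x‖ ^ 2 ≤ 1 / (p - 1) := by
      refine (pow_le_pow_left₀ (norm_nonneg _) hx 2).trans_eq ?_
      rw [div_pow, one_pow, Real.sq_sqrt hs.le]
    have h2 := (le_div_iff₀ hs).1 h1
    linarith
  refine ⟨fun p q q' h h' => ?_, fun p q h => ⟨fun _ hp => ?_, fun _ hp => ?_, fun hp hp' hle => ?_,
    fun hp hle => ?_⟩⟩
  · by_contra hne
    exact hvanish 0 (fun x => by simp) fun x => by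
      rw [h.radialGradSq_eq_zero_of_ne h' hne hcov hσ x, mul_zero]
  -- Here q < 0 is stronger than the claim, since -1 - p ≥ 0.
  · have := hneg p q h (by linarith) (hsmall p (by linarith))
    linarith
  · exact hneg p q h (by linarith) (hsmall p hp)
  · exact hneg p q h hp' (hsup p hp hle)
  · by_contra! hq
    -- With this exponent 2a + 2q ≥ 0 reads q ≥ 1 - p/2, and the coefficient of u is zero.
    exact hexcl p q (p / 2 - 1) h (hsup p (by linarith) hle) (by linarith) (by ring_nf; rfl)
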